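/- Consider the errors-in-variables model $y=X\theta+\xi$, $Z=X+W$, where only $y\in\mathbb R^n$ and the $n\times p$ matrix $Z$ are observed ($n\ge 1$), and denote by $\mathbb P_{X,\theta}$ the distribution of the pair $(y,Z)$ when the unknown parameter is $\theta\in\mathbb R^p$. Assume that $\xi$, $X$ and $W$ are jointly independent, that the components of $\xi\in\mathbb R^n$ are i.i.d. $\mathcal N(0,\sigma^2)$ and the entries of the $n\times p$ matrix $W$ are i.i.d. $\mathcal N(0,\sigma_*^2)$ with $\sigma^2>0$ and $\sigma_*^2>0$, and that the rows of the $n\times p$ matrix $X$ are i.i.d. Gaussian zero-mean random vectors with positive definite covariance matrix $\Sigma$, whose smallest and largest eigenvalues are denoted by $\lambda_{\min}^\Sigma$ and $\lambda_{\max}^\Sigma$. Let $|\cdot|_q$ be the $\ell_q$-norm on $\mathbb R^p$, let $B_0(s)$ be the set of $\theta\in\mathbb R^p$ with at most $s$ non-zero components, and let $S_2(R)=\{\theta\in\mathbb R^p:|\theta|_2=R\}$. Let $p\ge 2$, $1\le q\le\infty$, $2\le s\le p$ and $R>0$, and let $s\log(p/s)/n\le \bar c R^2/(R^2+1)$ for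 some constant $\bar c>0$. Then there exist constants $c>0$ and $c'>0$, depending only on $q,\sigma^2,\sigma_*^2,\bar c,\lambda_{\min}^\Sigma$ and $\lambda_{\max}^\Sigma$, such that $$ \inf_{\hat T}\ \sup_{\theta\in B_0(s)\cap S_2(R)} \mathbb P_{X,\theta}\Big[\,|\hat T-\theta|_q\ \ge\ c\,s^{1/q}\sqrt{\frac{\log(p/s)}{n}}\,(R+1)\Big]\ >\ c', $$ where the infimum is over all estimators, that is, all measurable functions $\hat T$ of $(y,Z)$ with values in $\mathbb R^p$, and $s^{1/\infty}=1$. -/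

import Mathlib

open MeasureTheory ProbabilityTheory
open scoped ENNReal NNReal

noncomputable section

namespace EIV

/-- `ℝ^p`, with the Euclidean norm. -/
abbrev Vec (p : ℕ) : Type := EuclideanSpace ℝ (Fin p)

/-- Real `n × p` matrices, given by their `n` rows in `ℝ^p`. -/
abbrev Rows (n p : ℕ) : Type := Fin n → Vec p

/-- The observations: a pair `(y, Z)` of a response vector in `ℝ^n` and an `n × p` matrix. -/
abbrev Obs (n p : ℕ) : Type := Vec n × Rows n p

/-- The `ℓ_q` norm on `ℝ^p`: `(∑ |v_j|^q)^(1/q)` for `1 ≤ q < ∞`, and `max |v_j|` for `q = ∞`. -/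
def lqNorm {p : ℕ} (q : ℝ≥0∞) (v : Vec p) : ℝ :=
  ‖(WithLp.toLp q (fun j => v j) : PiLp q (fun _ : Fin p => ℝ))‖

/-- The class `B_0(s)` of vectors with at most `s` non-zero components. -/
def B0 (p s : ℕ) : Set (Vec p) :=
  {θ | {j : Fin p | θ j ≠ 0}.ncard ≤ s}

/-- The Euclidean sphere `S_2(R)` of radius `R` around the origin. -/
def S2 (p : ℕ) (R : ℝ) : Set (Vec p) :=
  {θ | ‖θ‖ = R}

/-- Gaussian design and Gaussian noises: `ξ`, `X`, `W` are jointly independent, the components of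
`ξ` are i.i.d. `N(0, v)`, the entries of `W` are i.i.d. `N(0, w)`, and the rows of `X` are i.i.d.
`N(0, S)`, where `v > 0`, `w > 0` and `S` is positive definite. -/
structure GaussianDesignNoise {Ω : Type*} [MeasurableSpace Ω] (P : Measure Ω) {n p : ℕ}
    (ξ : Ω → Vec n) (X W : Ω → Rows n p) (v w : ℝ≥0) (S : Matrix (Fin p) (Fin p) ℝ) : Prop where
  v_pos : 0 < v
  w_pos : 0 < w
  posDef : S.PosDef
  /-- The distribution of each component of `ξ`. -/
  noise_law : ∀ i, HasLaw (fun ω => ξ ω i) (gaussianReal 0 v) P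
  noise_indep : iIndepFun (fun (i : Fin n) ω => ξ ω i) P
  /-- The distribution of each entry of `W`. -/
  error_law : ∀ i j, HasLaw (fun ω => W ω i j) (gaussianReal 0 w) P
  error_indep : iIndepFun (fun (ij : Fin n × Fin p) ω => W ω ij.1 ij.2) P
  /-- The distribution of each row of `X`. -/
  design_law : ∀ i, HasLaw (fun ω => X ω i) (multivariateGaussian 0 S) P
  design_indep : iIndepFun (fun (i : Fin n) ω => X ω i) P
  /-- Joint independence of the triplet `(ξ, X, W)`. -/
  indep_noise : IndepFun ξ (fun ω => (X ω, W ω)) P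
  indep_design_error : IndepFun X W P

/-- The observed pair `(y, Z)`, with `y = X θ + ξ` and `Z = X + W`. -/
def observe {n p : ℕ} (θ : Vec p) (ξ : Vec n) (X W : Rows n p) : Obs n p :=
  (WithLp.toLp 2 (fun i => (∑ j, X i j * θ j) + ξ i), X + W)

/-- The distribution of the observed pair `(y, Z)` when the unknown parameter is `θ`. -/
def obsLaw {Ω : Type*} [MeasurableSpace Ω] (P : Measure Ω) {n p : ℕ}
    (ξ : Ω → Vec n) (X W : Ω → Rows n p) (θ : Vec p) : Measure (Obs n p) :=
  P.map (fun ω => observe θ (ξ ω) (X ω) (W ω))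

end EIV

end

/-! Write `X = X₁ + X₂` with independent rows `X₁ ∼ N(0, Σ - l I)` and `X₂ ∼ N(0, l I)`, where `l`
is the smallest eigenvalue of `Σ`. Given `G = X₂ + W`, the row `X₂` has mean `a G` with `a = l / (l
+ w)` and covariance `w a I`. So `y` is a Gaussian regression on `X₁ + a G`, with noise variance `v
+ w a ‖θ‖²` (`rowLaw_eq`). This variance, of order `R² + 1`, is the source of the factor `R + 1` in
the rate, and it is constant on the sphere `S_2(R)`.

Two parameters on the sphere therefore give regressions with the same covariates and the same noise
level. Revealing `X₁` and `G` separately only makes the data finer, so it suffices to bound the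
second moment of that regression's likelihood ratio. It is a Gaussian exponential moment, and over
`n` rows it is at most `exp(n u)` with `u` of order `‖θ - θ'‖² / (R² + 1)` (`obsLaw_sq_le`).

The hypotheses have `k ≍ s` blocks of `m` coordinates, one entry `ε ≍ √(log(p/s)/n) (R + 1)` in each
block, and one large entry that brings the norm to `R`. Moving the entry of one block costs a factor
`exp(κ log(p/s)) ≤ 0.81 m`, too small for locating it among `m` positions (`sum_real_disjoint_le`).
Averaging over all configurations yields one in which a fixed fraction of the blocks is misjudged
with probability at least `1/20`; each such block has a coordinate with error at least `ε / 2`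
(`exists_blockVec_le`). When `s = p` the rate vanishes and the bound is trivial. -/

noncomputable section

namespace EIV

/-! ### Second moments of likelihood ratios and product measures -/

section ChiSquare

variable {α : Type*} [MeasurableSpace α]

/-- Cauchy–Schwarz for a change of measure. -/
lemma withDensity_apply_sq_le (μ : Measure α) {L : α → ℝ≥0∞} (hL : Measurable L) {A : Set α}
    (hA : MeasurableSet A) :
    (μ.withDensity L A) ^ 2 ≤ (∫⁻ x, L x ^ 2 ∂μ) * μ A := by
  have h := ENNReal.lintegral_mul_le_Lp_mul_Lq μ Real.HolderConjugate.two_two hL.aemeasurable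
    (g := A.indicator 1) ((measurable_const.indicator hA).aemeasurable)
  have h1 : ∫⁻ a, (L * A.indicator (1 : α → ℝ≥0∞)) a ∂μ = μ.withDensity L A := by
    rw [withDensity_apply _ hA, ← lintegral_indicator hA]
    refine lintegral_congr fun x => ?_
    by_cases hx : x ∈ A <;> simp [hx]
  have h2 : ∫⁻ a, (A.indicator (1 : α → ℝ≥0∞)) a ^ (2 : ℝ) ∂μ = μ A := by
    rw [← lintegral_indicator_one hA]
    refine lintegral_congr fun x => ?_
    by_cases hx : x ∈ A <;> simp [hx]
  rw [h1, h2, ← ENNReal.mul_rpow_of_nonneg _ _ (by norm_num)] at h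
  calc (μ.withDensity L A) ^ 2 ≤ (((∫⁻ x, L x ^ (2 : ℝ) ∂μ) * μ A) ^ (1 / 2 : ℝ)) ^ 2 := by gcongr
    _ = (∫⁻ x, L x ^ 2 ∂μ) * μ A := by
      rw [← ENNReal.rpow_natCast, ← ENNReal.rpow_mul]
      simp

lemma lintegral_pi_prod {ι : Type*} [Fintype ι] (κ : Measure α) [IsProbabilityMeasure κ]
    {f : ι → α → ℝ≥0∞} (hf : ∀ i, Measurable (f i)) :
    ∫⁻ x, ∏ i, f i (x i) ∂(Measure.pi fun _ : ι => κ) = ∏ i, ∫⁻ x, f i x ∂κ := by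
  have h := lintegral_prod_eq_prod_lintegral_of_indepFun (μ := Measure.pi fun _ : ι => κ)
    Finset.univ (fun i x => f i (x i))
    (iIndepFun_pi (μ := fun _ : ι => κ) (X := f) fun i => (hf i).aemeasurable)
    (fun i => (hf i).comp (measurable_pi_apply i))
  rw [h]
  refine Finset.prod_congr rfl fun i _ => ?_
  exact (measurePreserving_eval (fun _ : ι => κ) i).lintegral_comp (hf i)

lemma pi_withDensity_eq {ι : Type*} [Fintype ι] (κ : Measure α) [IsProbabilityMeasure κ]
    {L : α → ℝ≥0∞} (hL : Measurable L) [IsProbabilityMeasure (κ.withDensity L)] :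
    Measure.pi (fun _ : ι => κ.withDensity L) =
      (Measure.pi fun _ : ι => κ).withDensity (fun x => ∏ i, L (x i)) := by
  refine Measure.pi_eq fun s hs => ?_
  rw [withDensity_apply _ (MeasurableSet.univ_pi hs),
    ← lintegral_indicator (MeasurableSet.univ_pi hs)]
  simp_rw [withDensity_apply _ (hs _), ← lintegral_indicator (hs _)]
  rw [← lintegral_pi_prod κ (fun i => hL.indicator (hs i))]
  refine lintegral_congr fun x => ?_
  by_cases hx : x ∈ Set.univ.pi s
  · rw [Set.indicator_of_mem hx]
    exact Finset.prod_congr rfl fun i _ => by rw [Set.indicator_of_mem (hx i trivial)]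
  · rw [Set.indicator_of_notMem hx]
    simp only [Set.mem_pi, Set.mem_univ, true_implies, not_forall] at hx
    obtain ⟨i, hi⟩ := hx
    rw [Finset.prod_eq_zero (Finset.mem_univ i) (by rw [Set.indicator_of_notMem hi])]

/-- The likelihood ratio of a product is the product of the ratios, so its second moment is the
`n`-th power of the one for a single row. -/
lemma pi_withDensity_apply_sq_le (n : ℕ) (κ : Measure α) [IsProbabilityMeasure κ]
    {L : α → ℝ≥0∞} (hL : Measurable L) [IsProbabilityMeasure (κ.withDensity L)]
    {A : Set (Fin n → α)} (hA : MeasurableSet A) :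
    (Measure.pi (fun _ : Fin n => κ.withDensity L) A) ^ 2 ≤
      (∫⁻ x, L x ^ 2 ∂κ) ^ n * Measure.pi (fun _ : Fin n => κ) A := by
  rw [pi_withDensity_eq κ hL]
  refine (withDensity_apply_sq_le _ ?_ hA).trans_eq ?_
  · exact Finset.measurable_prod _ fun i _ => hL.comp (measurable_pi_apply i)
  · simp_rw [← Finset.prod_pow]
    rw [lintegral_pi_prod κ (fun _ => hL.pow_const 2)]
    simp

end ChiSquare

/-! ### Gaussian regressions with a common noise level -/

section Regression

variable {D : Type*} [MeasurableSpace D]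

/-- The joint law of a covariate `d ∼ ρ` and a response `y ∼ N(m d, t)`. -/
def regressionLaw (ρ : Measure D) (t : ℝ≥0) (m : D → ℝ) : Measure (D × ℝ) :=
  (ρ.prod volume).withDensity (fun z => gaussianPDF (m z.1) t z.2)

lemma measurable_gaussianPDF_comp {t : ℝ≥0} {m : D → ℝ} (hm : Measurable m) :
    Measurable (fun z : D × ℝ => gaussianPDF (m z.1) t z.2) :=
  measurable_uncurry_gaussianPDF.comp
    ((hm.comp measurable_fst).prodMk (measurable_const.prodMk measurable_snd))

lemma map_prod_gaussianReal (ρ : Measure D) [IsProbabilityMeasure ρ] {t : ℝ≥0} (ht : t ≠ 0)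
    {m : D → ℝ} (hm : Measurable m) :
    (ρ.prod (gaussianReal 0 t)).map (fun z => (z.1, m z.1 + z.2)) = regressionLaw ρ t m := by
  ext A hA
  have hg : Measurable (fun z : D × ℝ => (z.1, m z.1 + z.2)) := by fun_prop
  rw [Measure.map_apply hg hA, Measure.prod_apply (hg hA), regressionLaw, withDensity_apply _ hA,
    ← lintegral_indicator hA, lintegral_prod _
      ((measurable_gaussianPDF_comp hm).indicator hA).aemeasurable]
  refine lintegral_congr fun d => ?_
  have hAd : MeasurableSet (Prod.mk d ⁻¹' A) := measurable_prodMk_left hA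
  have h1 : gaussianReal 0 t (Prod.mk d ⁻¹' ((fun z : D × ℝ => (z.1, m z.1 + z.2)) ⁻¹' A)) =
      ((gaussianReal 0 t).map (fun x => m d + x)) (Prod.mk d ⁻¹' A) := by
    rw [Measure.map_apply (by fun_prop) hAd]; rfl
  rw [h1, gaussianReal_map_const_add, zero_add, gaussianReal_apply _ ht, ← lintegral_indicator hAd]
  rfl

lemma isProbabilityMeasure_regressionLaw (ρ : Measure D) [IsProbabilityMeasure ρ] {t : ℝ≥0}
    (ht : t ≠ 0) {m : D → ℝ} (hm : Measurable m) : IsProbabilityMeasure (regressionLaw ρ t m) := by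
  rw [← map_prod_gaussianReal ρ ht hm]
  exact Measure.isProbabilityMeasure_map (by fun_prop)

/-- The likelihood ratio of two regression laws. -/
def regressionRatio (t : ℝ≥0) (m m' : D → ℝ) (z : D × ℝ) : ℝ≥0∞ :=
  ENNReal.ofReal (Real.exp (((z.2 - m' z.1) ^ 2 - (z.2 - m z.1) ^ 2) / (2 * t)))

lemma measurable_regressionRatio (t : ℝ≥0) {m m' : D → ℝ} (hm : Measurable m)
    (hm' : Measurable m') : Measurable (regressionRatio t m m') := by
  unfold regressionRatio
  fun_prop

omit [MeasurableSpace D] in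
lemma gaussianPDF_mul_ratio (t : ℝ≥0) (m m' : D → ℝ) (z : D × ℝ) :
    gaussianPDF (m' z.1) t z.2 * regressionRatio t m m' z = gaussianPDF (m z.1) t z.2 := by
  rw [gaussianPDF, gaussianPDF, regressionRatio,
    ← ENNReal.ofReal_mul (gaussianPDFReal_nonneg _ _ _), gaussianPDFReal, gaussianPDFReal, mul_assoc,
    ← Real.exp_add]
  congr 3
  ring

omit [MeasurableSpace D] in
-- Completing the square in the response recentres the density at `2 m - m'`. The Gaussian factor
-- then integrates to one, leaving only an exponential moment of `(m - m')²` over the covariate.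
lemma gaussianPDF_mul_ratio_sq {t : ℝ≥0} (ht : t ≠ 0) (m m' : D → ℝ) (z : D × ℝ) :
    gaussianPDF (m' z.1) t z.2 * regressionRatio t m m' z ^ 2 =
      ENNReal.ofReal (Real.exp ((m z.1 - m' z.1) ^ 2 / t)) *
        gaussianPDF (2 * m z.1 - m' z.1) t z.2 := by
  have ht' : (t : ℝ) ≠ 0 := by exact_mod_cast ht
  rw [gaussianPDF, gaussianPDF, regressionRatio, ← ENNReal.ofReal_pow (Real.exp_pos _).le,
    ← ENNReal.ofReal_mul (gaussianPDFReal_nonneg _ _ _), ← ENNReal.ofReal_mul (Real.exp_pos _).le,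
    gaussianPDFReal, gaussianPDFReal, mul_assoc, mul_left_comm (Real.exp _), ← Real.exp_nat_mul,
    ← Real.exp_add, ← Real.exp_add]
  congr 3
  field_simp
  push_cast
  ring

lemma regressionLaw_eq_withDensity (ρ : Measure D) (t : ℝ≥0) {m m' : D → ℝ} (hm : Measurable m)
    (hm' : Measurable m') :
    regressionLaw ρ t m = (regressionLaw ρ t m').withDensity (regressionRatio t m m') := by
  rw [regressionLaw, regressionLaw, ← withDensity_mul _ (measurable_gaussianPDF_comp hm')
    (measurable_regressionRatio t hm hm')]
  congr 1
  ext z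
  exact (gaussianPDF_mul_ratio t m m' z).symm

lemma lintegral_regressionRatio_sq (ρ : Measure D) [SFinite ρ] {t : ℝ≥0} (ht : t ≠ 0) {m m' : D → ℝ}
    (hm : Measurable m) (hm' : Measurable m') :
    ∫⁻ z, regressionRatio t m m' z ^ 2 ∂(regressionLaw ρ t m') =
      ∫⁻ d, ENNReal.ofReal (Real.exp ((m d - m' d) ^ 2 / t)) ∂ρ := by
  rw [regressionLaw, lintegral_withDensity_eq_lintegral_mul _ (measurable_gaussianPDF_comp hm')
    ((measurable_regressionRatio t hm hm').pow_const 2)]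
  simp only [Pi.mul_apply, gaussianPDF_mul_ratio_sq ht]
  have h1 : Measurable fun z : D × ℝ =>
      ENNReal.ofReal (Real.exp ((m z.1 - m' z.1) ^ 2 / t)) := by fun_prop
  refine (lintegral_prod _ (h1.mul (measurable_gaussianPDF_comp
    (m := fun d => 2 * m d - m' d) (by fun_prop))).aemeasurable).trans ?_
  refine lintegral_congr fun d => ?_
  simp only [Pi.mul_apply]
  rw [lintegral_const_mul _ (measurable_gaussianPDF _ _), lintegral_gaussianPDF_eq_one _ ht, mul_one]

/-- Change of measure between the laws of two Gaussian regression samples of size `n`. -/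
lemma regressionLaw_pi_sq_le (n : ℕ) (ρ : Measure D) [IsProbabilityMeasure ρ] {t : ℝ≥0}
    (ht : t ≠ 0) {m m' : D → ℝ} (hm : Measurable m) (hm' : Measurable m')
    {A : Set (Fin n → D × ℝ)} (hA : MeasurableSet A) :
    (Measure.pi (fun _ : Fin n => regressionLaw ρ t m) A) ^ 2 ≤
      (∫⁻ d, ENNReal.ofReal (Real.exp ((m d - m' d) ^ 2 / t)) ∂ρ) ^ n *
        Measure.pi (fun _ : Fin n => regressionLaw ρ t m') A := by
  have := isProbabilityMeasure_regressionLaw ρ ht hm'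
  have h := isProbabilityMeasure_regressionLaw ρ ht hm
  rw [regressionLaw_eq_withDensity ρ t hm hm'] at h ⊢
  rw [← lintegral_regressionRatio_sq ρ ht hm hm']
  exact pi_withDensity_apply_sq_le n _ (measurable_regressionRatio t hm hm') hA

end Regression

/-! ### Exponential moment of a squared Gaussian -/

section GaussianSquare

/-- For `x ≠ 0` the integral equals `(1 - u)^(-1/2)` with `u = 2 b x`. For `0 ≤ u ≤ 1/2` one has `(1
+ u)² (1 - u) ≥ 1`, and `1 + u ≤ exp u` gives the bound. -/
lemma lintegral_exp_mul_sq_gaussianReal {x : ℝ≥0} {b : ℝ} (hx : 2 * b * x ≤ 1 / 2) (hb : 0 ≤ b) :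
    ∫⁻ z, ENNReal.ofReal (Real.exp (b * z ^ 2)) ∂(gaussianReal 0 x) ≤
      ENNReal.ofReal (Real.exp (2 * b * x)) := by
  rcases eq_or_ne x 0 with rfl | h0
  · simp
  have hx0 : (0 : ℝ) < x := by positivity
  rw [gaussianReal_of_var_ne_zero _ h0, lintegral_withDensity_eq_lintegral_mul _
    (measurable_gaussianPDF _ _) (by fun_prop)]
  set β : ℝ := 1 / (2 * x) - b with hβ
  have hβx : 2 * x * β = 1 - 2 * b * x := by rw [hβ]; field_simp
  have hβ0 : 0 < β := by
    by_contra h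
    push Not at h
    have : 2 * x * β ≤ 0 := mul_nonpos_of_nonneg_of_nonpos (by positivity) h
    linarith
  have h1 : ∀ z : ℝ, (gaussianPDF 0 x * fun z => ENNReal.ofReal (Real.exp (b * z ^ 2))) z =
      ENNReal.ofReal ((√(2 * Real.pi * x))⁻¹ * Real.exp (-β * z ^ 2)) := by
    intro z
    rw [Pi.mul_apply, gaussianPDF, ← ENNReal.ofReal_mul (gaussianPDFReal_nonneg _ _ _),
      gaussianPDFReal, mul_assoc, ← Real.exp_add]
    congr 3
    rw [hβ]
    field_simp
    ring
  simp_rw [h1]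
  rw [← ofReal_integral_eq_lintegral_ofReal ((integrable_exp_neg_mul_sq hβ0).const_mul _)
    (Filter.Eventually.of_forall fun z => by positivity), integral_const_mul, integral_gaussian]
  refine ENNReal.ofReal_le_ofReal ?_
  rw [← Real.sqrt_inv, ← Real.sqrt_mul (by positivity)]
  have h2 : (2 * Real.pi * x)⁻¹ * (Real.pi / β) = (1 - 2 * b * x)⁻¹ := by
    rw [← hβx]; field_simp
  rw [h2]
  set u := 2 * b * (x : ℝ)
  have hu : 0 ≤ u := by positivity
  rw [Real.sqrt_le_left (Real.exp_pos _).le, ← Real.exp_nat_mul]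
  have h3 : 1 + u ≤ Real.exp u := by linarith [Real.add_one_le_exp u]
  have h4 : Real.exp u ^ 2 = Real.exp ((2 : ℕ) * u) := by rw [← Real.exp_nat_mul]
  rw [← h4, inv_le_iff_one_le_mul₀ (by linarith)]
  have h5 : (1 + u) ^ 2 ≤ Real.exp u ^ 2 := by gcongr
  nlinarith [mul_nonneg hu (by linarith : 0 ≤ 1 - 2 * u), mul_nonneg hu hu,
    mul_le_mul_of_nonneg_right h5 (by linarith : 0 ≤ 1 - u)]

end GaussianSquare

/-! ### Splitting the design: two descriptions of one observed row -/

section RowLaw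

variable {n p : ℕ}

/-- The law on `ℝ^p` of a vector of i.i.d. `N(0, u)` components. -/
def isoGaussian (p : ℕ) (u : ℝ≥0) : Measure (Vec p) :=
  (Measure.pi fun _ : Fin p => gaussianReal 0 u).map (WithLp.toLp 2)

instance (p : ℕ) (u : ℝ≥0) : IsProbabilityMeasure (isoGaussian p u) :=
  Measure.isProbabilityMeasure_map (by fun_prop)

lemma charFun_isoGaussian (u : ℝ≥0) (t : Vec p) :
    charFun (isoGaussian p u) t = Complex.exp ((-(u * ‖t‖ ^ 2 / 2) : ℝ)) := by
  rw [isoGaussian, charFun_pi]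
  simp_rw [charFun_gaussianReal, ← Complex.exp_sum]
  rw [EuclideanSpace.real_norm_sq_eq]
  congr 1
  push_cast
  simp [Finset.mul_sum, Finset.sum_div]

lemma charFun_centred_multivariateGaussian {S : Matrix (Fin p) (Fin p) ℝ} (hS : S.PosSemidef)
    (t : Vec p) :
    charFun (multivariateGaussian 0 S) t =
      Complex.exp ((-(t.ofLp ⬝ᵥ S.mulVec t.ofLp / 2) : ℝ)) := by
  rw [charFun_multivariateGaussian hS]
  simp

/-- One observed row `(y, z)` as a function of the two summands `d.1`, `d.2` of `z` and the noise. -/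
def rowMap (b : ℝ) (θ : Vec p) (z : (Vec p × Vec p) × ℝ) : ℝ × Vec p :=
  (inner ℝ (z.1.1 + b • z.1.2) θ + z.2, z.1.1 + z.1.2)

@[fun_prop]
lemma measurable_rowMap (b : ℝ) (θ : Vec p) : Measurable (rowMap b θ) := by
  unfold rowMap
  fun_prop

/-- `rowMap` is linear in its three independent inputs, and every functional has the form `(y, z) ↦
t y + ⟪z, u⟫`. Hence the characteristic function factors, which reduces `rowLaw_eq` to an identity
of quadratic forms. -/
lemma charFunDual_map_rowMap (b : ℝ) (θ : Vec p) (μ ν : Measure (Vec p)) (η : Measure ℝ)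
    [IsProbabilityMeasure μ] [IsProbabilityMeasure ν] [IsProbabilityMeasure η]
    (L : StrongDual ℝ (ℝ × Vec p)) :
    charFunDual (((μ.prod ν).prod η).map (rowMap b θ)) L =
      charFun μ (L (1, 0) • θ + (InnerProductSpace.toDual ℝ (Vec p)).symm (L.comp (.inr ℝ ℝ _))) *
      charFun ν ((b * L (1, 0)) • θ +
        (InnerProductSpace.toDual ℝ (Vec p)).symm (L.comp (.inr ℝ ℝ _))) *
      charFun η (L (1, 0)) := by
  set t := L (1, 0)
  set u := (InnerProductSpace.toDual ℝ (Vec p)).symm (L.comp (.inr ℝ ℝ _)) with hu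
  have hL : ∀ y z, L (y, z) = t * y + inner ℝ z u := by
    intro y z
    have h1 : inner ℝ z u = L (0, z) := by
      rw [real_inner_comm, hu, InnerProductSpace.toDual_symm_apply]; simp
    have h2 : ((y, z) : ℝ × Vec p) = y • (1, 0) + (0, z) := by simp
    rw [h1, h2, map_add, map_smul, smul_eq_mul, mul_comm]
  rw [charFunDual_apply, integral_map (by fun_prop) (by fun_prop)]
  simp only [charFun_apply]
  rw [← integral_prod_mul, ← integral_prod_mul]
  refine integral_congr_ae (Filter.Eventually.of_forall fun z => ?_)
  simp only [rowMap, hL]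
  rw [← Complex.exp_add, ← Complex.exp_add]
  congr 1
  simp only [inner_add_left, inner_add_right, inner_smul_left, inner_smul_right,
    RCLike.inner_apply, conj_trivial]
  push_cast
  ring

lemma dotProduct_smul_one_mulVec (l : ℝ) (S : Matrix (Fin p) (Fin p) ℝ) (x : Vec p) :
    x.ofLp ⬝ᵥ (S - l • 1).mulVec x.ofLp = x.ofLp ⬝ᵥ S.mulVec x.ofLp - l * ‖x‖ ^ 2 := by
  rw [Matrix.sub_mulVec, dotProduct_sub, Matrix.smul_mulVec, Matrix.one_mulVec, dotProduct_smul,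
    EuclideanSpace.real_norm_sq_eq]
  simp [dotProduct, pow_two]

lemma posSemidef_sub_smul_one {S : Matrix (Fin p) (Fin p) ℝ} (hS : S.PosSemidef) {l : ℝ}
    (hl : l ∈ lowerBounds (spectrum ℝ S)) : (S - l • (1 : Matrix (Fin p) (Fin p) ℝ)).PosSemidef := by
  rw [Matrix.posSemidef_iff_isHermitian_and_spectrum_nonneg]
  refine ⟨hS.isHermitian.sub (by simp [Matrix.IsHermitian]), ?_⟩
  rw [← Algebra.algebraMap_eq_smul_one, ← spectrum.sub_singleton_eq]
  rintro _ ⟨a, ha, b, rfl, rfl⟩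
  simpa using hl ha

lemma dotProduct_mulVec_le {S : Matrix (Fin p) (Fin p) ℝ} (hS : S.PosSemidef) {l : ℝ}
    (hl : l ∈ upperBounds (spectrum ℝ S)) (x : Vec p) :
    x.ofLp ⬝ᵥ S.mulVec x.ofLp ≤ l * ‖x‖ ^ 2 := by
  have h : (l • (1 : Matrix (Fin p) (Fin p) ℝ) - S).PosSemidef := by
    rw [Matrix.posSemidef_iff_isHermitian_and_spectrum_nonneg]
    refine ⟨Matrix.IsHermitian.sub (by simp [Matrix.IsHermitian]) hS.isHermitian, ?_⟩
    rw [← Algebra.algebraMap_eq_smul_one, ← spectrum.singleton_sub_eq]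
    rintro _ ⟨b, rfl, a, ha, rfl⟩
    simpa using hl ha
  have h1 := h.re_dotProduct_nonneg x.ofLp
  have h2 := dotProduct_smul_one_mulVec l S x
  rw [← neg_sub, Matrix.neg_mulVec, dotProduct_neg] at h1
  simp only [star_trivial, RCLike.re_to_real] at h1
  linarith

/-- The law of one observed row. -/
def rowLaw (v w : ℝ≥0) (S : Matrix (Fin p) (Fin p) ℝ) (θ : Vec p) : Measure (ℝ × Vec p) :=
  (((multivariateGaussian 0 S).prod (isoGaussian p w)).prod (gaussianReal 0 v)).map (rowMap 0 θ)

instance (v w : ℝ≥0) (S : Matrix (Fin p) (Fin p) ℝ) (θ : Vec p) :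
    IsProbabilityMeasure (rowLaw v w S θ) :=
  Measure.isProbabilityMeasure_map (by fun_prop)

/-- Splitting off an isotropic part of variance `l` from the design: the observed row is also
a regression on a covariate whose conditional noise level depends on `θ` through `‖θ‖` only. -/
lemma rowLaw_eq (v w l a : ℝ≥0) (ha : a * (l + w) = l) {S : Matrix (Fin p) (Fin p) ℝ}
    (hS : S.PosSemidef) (hl : (l : ℝ) ∈ lowerBounds (spectrum ℝ S)) (θ : Vec p) {t : ℝ≥0}
    (ht : (t : ℝ) = v + w * a * ‖θ‖ ^ 2) :
    rowLaw v w S θ =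
      (((multivariateGaussian 0 (S - (l : ℝ) • 1)).prod (isoGaussian p (l + w))).prod
        (gaussianReal 0 t)).map (rowMap a θ) := by
  have hf : IsFiniteMeasure ((((multivariateGaussian 0 (S - (l : ℝ) • 1)).prod
      (isoGaussian p (l + w))).prod (gaussianReal 0 t)).map (rowMap a θ)) := by
    have := Measure.isProbabilityMeasure_map (μ := ((multivariateGaussian 0 (S - (l : ℝ) • 1)).prod
      (isoGaussian p (l + w))).prod (gaussianReal 0 t)) (f := rowMap a θ) (by fun_prop)
    infer_instance
  refine Measure.ext_of_charFunDual (funext fun L => ?_)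
  rw [rowLaw, charFunDual_map_rowMap, charFunDual_map_rowMap]
  generalize L (1, 0) = s
  generalize (InnerProductSpace.toDual ℝ (Vec p)).symm (L.comp (.inr ℝ ℝ _)) = u
  rw [charFun_centred_multivariateGaussian hS,
    charFun_centred_multivariateGaussian (posSemidef_sub_smul_one hS hl), dotProduct_smul_one_mulVec]
  simp only [charFun_isoGaussian, charFun_gaussianReal]
  rw [← Complex.exp_add, ← Complex.exp_add, ← Complex.exp_add, ← Complex.exp_add]
  congr 1
  have hN : ∀ c : ℝ, ‖c • θ + u‖ ^ 2 = c ^ 2 * ‖θ‖ ^ 2 + 2 * c * inner ℝ θ u + ‖u‖ ^ 2 := by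
    intro c
    rw [norm_add_sq_real, norm_smul, inner_smul_left, mul_pow, Real.norm_eq_abs, sq_abs]
    simp; ring
  rw [hN, hN, hN]
  have ha' : (a : ℝ) * (l + w) = l := by exact_mod_cast ha
  -- Equality of the two Gaussian exponents. The coefficients in `r²` and `i` match exactly because
  -- `a (l + w) = l`.
  have key : ∀ (Q r i m : ℝ), -(Q / 2) + -((w : ℝ) * ((0 * s) ^ 2 * r ^ 2 + 2 * (0 * s) * i + m) / 2)
      + -(v * s ^ 2 / 2) = -((Q - l * (s ^ 2 * r ^ 2 + 2 * s * i + m)) / 2) +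
      -((l + w) * ((a * s) ^ 2 * r ^ 2 + 2 * (a * s) * i + m) / 2) +
      -((v + w * a * r ^ 2) * s ^ 2 / 2) := by
    intro Q r i m
    linear_combination (a * s ^ 2 * r ^ 2 / 2 + s * i + s ^ 2 * r ^ 2 / 2) * ha'
  have h := congrArg (fun x : ℝ => (x : ℂ))
    (key ((s • θ + u).ofLp ⬝ᵥ S.mulVec (s • θ + u).ofLp) ‖θ‖ (inner ℝ θ u) (‖u‖ ^ 2))
  rw [← ht] at h
  push_cast at h ⊢
  simp only [mul_zero, zero_mul, zero_sub]
  linear_combination h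

end RowLaw

/-! ### The observations as `n` i.i.d. rows -/

section ObsLaw

variable {n p : ℕ}

/-- Assemble observed rows into an observation. -/
def assemble (r : Fin n → ℝ × Vec p) : Obs n p :=
  (WithLp.toLp 2 fun i => (r i).1, fun i => (r i).2)

@[fun_prop]
lemma measurable_assemble : Measurable (assemble : (Fin n → ℝ × Vec p) → Obs n p) := by
  unfold assemble
  fun_prop

lemma hasLaw_error {Ω : Type*} [MeasurableSpace Ω] {P : Measure Ω} {W : Ω → Rows n p} {w : ℝ≥0}
    (h1 : ∀ i j, HasLaw (fun ω => W ω i j) (gaussianReal 0 w) P)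
    (h2 : iIndepFun (fun (ij : Fin n × Fin p) ω => W ω ij.1 ij.2) P) :
    HasLaw W (Measure.pi fun _ => isoGaussian p w) P := by
  have h := h2.hasLaw_pi (fun ij : Fin n × Fin p => h1 ij.1 ij.2)
  have hc : HasLaw (MeasurableEquiv.curry (Fin n) (Fin p) ℝ)
      (Measure.pi fun _ : Fin n => Measure.pi fun _ : Fin p => gaussianReal 0 w)
      (Measure.pi fun _ : Fin n × Fin p => gaussianReal 0 w) := by
    refine ⟨by fun_prop, ?_⟩
    have := Measure.infinitePi_map_curry (fun (_ : Fin n) (_ : Fin p) => gaussianReal 0 w)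
    simpa only [Measure.infinitePi_eq_pi] using this
  have hl : HasLaw (fun (x : Fin n → Fin p → ℝ) i => (WithLp.toLp 2 (x i) : Vec p))
      (Measure.pi fun _ => isoGaussian p w)
      (Measure.pi fun _ : Fin n => Measure.pi fun _ : Fin p => gaussianReal 0 w) :=
    ⟨Measurable.aemeasurable (by fun_prop), Measure.pi_map_pi (fun _ => by fun_prop)⟩
  exact (hl.comp (hc.comp h))

lemma obsLaw_eq {Ω : Type*} [MeasurableSpace Ω] {P : Measure Ω} [IsProbabilityMeasure P]
    {ξ : Ω → Vec n} {X W : Ω → Rows n p} {v w : ℝ≥0} {S : Matrix (Fin p) (Fin p) ℝ}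
    (h : GaussianDesignNoise P ξ X W v w S) (θ : Vec p) :
    obsLaw P ξ X W θ = (Measure.pi fun _ : Fin n => rowLaw v w S θ).map assemble := by
  have hX := h.design_indep.hasLaw_pi h.design_law
  have hW := hasLaw_error h.error_law h.error_indep
  have hξ := h.noise_indep.hasLaw_pi h.noise_law
  have hXW := h.indep_design_error.hasLaw_prod hX hW
  have hall : HasLaw (fun ω => ((X ω, W ω), fun i => ξ ω i)) _ P :=
    (h.indep_noise.symm.comp measurable_id
      (by fun_prop : Measurable (fun (x : Vec n) i => x i))).hasLaw_prod hXW hξ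
  have m1 := measurePreserving_arrowProdEquivProdArrow (Vec p × Vec p) ℝ (Fin n)
    (fun _ => (multivariateGaussian 0 S).prod (isoGaussian p w)) (fun _ => gaussianReal 0 v)
  have m2 := measurePreserving_arrowProdEquivProdArrow (Vec p) (Vec p) (Fin n)
    (fun _ => multivariateGaussian 0 S) (fun _ => isoGaussian p w)
  have m3 := (m2.prod (MeasurePreserving.id (Measure.pi fun _ : Fin n => gaussianReal 0 v))).comp m1
  have hg : Measurable fun z : (Rows n p × Rows n p) × (Fin n → ℝ) =>
      assemble fun i => rowMap 0 θ ((z.1.1 i, z.1.2 i), z.2 i) := by fun_prop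
  have e1 : obsLaw P ξ X W θ = (P.map (fun ω => ((X ω, W ω), fun i => ξ ω i))).map
      (fun z : (Rows n p × Rows n p) × (Fin n → ℝ) =>
        assemble fun i => rowMap 0 θ ((z.1.1 i, z.1.2 i), z.2 i)) := by
    rw [AEMeasurable.map_map_of_aemeasurable hg.aemeasurable hall.aemeasurable, obsLaw]
    congr 1
    funext ω
    simp only [Function.comp, assemble, rowMap, observe, PiLp.inner_apply]
    simp [mul_comm]
    rfl
  unfold rowLaw
  rw [e1, hall.map_eq, ← m3.map_eq, Measure.map_map hg m3.measurable,
    ← Measure.pi_map_pi (fun _ => by fun_prop), Measure.map_map (by fun_prop) (by fun_prop)]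
  rfl

end ObsLaw

/-! ### Change of measure on the sphere -/

section ObsChangeOfMeasure

variable {n p : ℕ}

lemma map_inner_prod_eq_gaussianReal (a u : ℝ≥0) {S : Matrix (Fin p) (Fin p) ℝ} (hS : S.PosSemidef)
    (δ : Vec p) {x : ℝ≥0} (hx : (x : ℝ) = δ.ofLp ⬝ᵥ S.mulVec δ.ofLp + a ^ 2 * u * ‖δ‖ ^ 2) :
    ((multivariateGaussian 0 S).prod (isoGaussian p u)).map
      (fun d => inner ℝ (d.1 + (a : ℝ) • d.2) δ) = gaussianReal 0 x := by
  have : IsProbabilityMeasure (((multivariateGaussian 0 S).prod (isoGaussian p u)).map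
      (fun d => inner ℝ (d.1 + (a : ℝ) • d.2) δ)) := Measure.isProbabilityMeasure_map (by fun_prop)
  refine Measure.ext_of_charFun (funext fun t => ?_)
  rw [charFun_apply, integral_map (by fun_prop) (by fun_prop)]
  have h1 : ∀ d : Vec p × Vec p,
      Complex.exp ((inner ℝ (inner ℝ (d.1 + (a : ℝ) • d.2) δ) t : ℝ) * Complex.I) =
      Complex.exp ((inner ℝ d.1 (t • δ) : ℝ) * Complex.I) *
        Complex.exp ((inner ℝ d.2 ((a * t) • δ) : ℝ) * Complex.I) := by
    intro d
    rw [← Complex.exp_add]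
    congr 1
    simp only [inner_add_left, inner_smul_left, inner_smul_right, RCLike.inner_apply, conj_trivial]
    push_cast
    ring
  simp_rw [h1]
  rw [integral_prod_mul (fun y : Vec p => Complex.exp ((inner ℝ y (t • δ) : ℝ) * Complex.I))
    (fun y : Vec p => Complex.exp ((inner ℝ y ((a * t) • δ) : ℝ) * Complex.I)), ← charFun_apply,
    ← charFun_apply, charFun_centred_multivariateGaussian hS, charFun_isoGaussian,
    charFun_gaussianReal, ← Complex.exp_add]
  congr 1
  have key : -((t • δ).ofLp ⬝ᵥ S.mulVec (t • δ).ofLp / 2) + -(u * ‖(a * t) • δ‖ ^ 2 / 2) =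
      -(x * t ^ 2 / 2) := by
    rw [hx, norm_smul, mul_pow, Real.norm_eq_abs, sq_abs]
    simp only [WithLp.ofLp_smul, Matrix.mulVec_smul, dotProduct_smul, smul_dotProduct, smul_eq_mul]
    ring
  have h := congrArg (fun x : ℝ => (x : ℂ)) key
  push_cast at h ⊢
  linear_combination h

/-- Exhibits `(y, Z)` as a statistic, not depending on `θ`, of the finer sample in which both
summands of each row of `Z` are seen. A change of measure for the finer sample thus transfers to
`obsLaw`. -/
lemma obsLaw_apply {Ω : Type*} [MeasurableSpace Ω] {P : Measure Ω} [IsProbabilityMeasure P]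
    {ξ : Ω → Vec n} {X W : Ω → Rows n p} {v w : ℝ≥0} {S : Matrix (Fin p) (Fin p) ℝ}
    (h : GaussianDesignNoise P ξ X W v w S) {l a : ℝ≥0} (ha : a * (l + w) = l)
    (hl : (l : ℝ) ∈ lowerBounds (spectrum ℝ S)) (θ : Vec p) {t : ℝ≥0}
    (ht : (t : ℝ) = v + w * a * ‖θ‖ ^ 2) (ht0 : t ≠ 0) {A : Set (Obs n p)} (hA : MeasurableSet A) :
    obsLaw P ξ X W θ A =
      Measure.pi (fun _ : Fin n => regressionLaw
        ((multivariateGaussian 0 (S - (l : ℝ) • 1)).prod (isoGaussian p (l + w))) t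
          (fun d => inner ℝ (d.1 + (a : ℝ) • d.2) θ))
        ((fun r => assemble fun i => ((r i).2, (r i).1.1 + (r i).1.2)) ⁻¹' A) := by
  have hm : Measurable fun d : Vec p × Vec p => (inner ℝ (d.1 + (a : ℝ) • d.2) θ : ℝ) := by fun_prop
  have hprob := isProbabilityMeasure_regressionLaw
    ((multivariateGaussian 0 (S - (l : ℝ) • 1)).prod (isoGaussian p (l + w))) ht0 hm
  have hg : Measurable fun r : Fin n → (Vec p × Vec p) × ℝ =>
      (assemble fun i => ((r i).2, (r i).1.1 + (r i).1.2) : Obs n p) := by fun_prop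
  have hrow : rowLaw v w S θ = (regressionLaw ((multivariateGaussian 0 (S - (l : ℝ) • 1)).prod
      (isoGaussian p (l + w))) t (fun d => inner ℝ (d.1 + (a : ℝ) • d.2) θ)).map
      (fun z => (z.2, z.1.1 + z.1.2)) := by
    rw [rowLaw_eq v w l a ha h.posDef.posSemidef hl θ ht, ← map_prod_gaussianReal _ ht0 hm,
      Measure.map_map (by fun_prop) (by fun_prop)]
    rfl
  have hrow' := hrow ▸ (inferInstance : IsProbabilityMeasure (rowLaw v w S θ))
  rw [obsLaw_eq h, hrow, ← Measure.pi_map_pi (fun _ => by fun_prop),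
    Measure.map_map (by fun_prop) (by fun_prop), Measure.map_apply (by fun_prop) hA]
  rfl

/-- Change of measure between the laws of the observations under two parameters of equal norm. -/
lemma obsLaw_sq_le {Ω : Type*} [MeasurableSpace Ω] {P : Measure Ω} [IsProbabilityMeasure P]
    {ξ : Ω → Vec n} {X W : Ω → Rows n p} {v w : ℝ≥0} {S : Matrix (Fin p) (Fin p) ℝ}
    (h : GaussianDesignNoise P ξ X W v w S) {l a : ℝ≥0} (ha : a * (l + w) = l)
    (hl : (l : ℝ) ∈ lowerBounds (spectrum ℝ S)) {l' : ℝ} (hl' : l' ∈ upperBounds (spectrum ℝ S))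
    {θ θ' : Vec p} (hθ : ‖θ‖ = ‖θ'‖) {u : ℝ}
    (hu : 2 * l' * ‖θ - θ'‖ ^ 2 / (v + w * a * ‖θ‖ ^ 2) ≤ u) (hu' : u ≤ 1 / 2)
    {A : Set (Obs n p)} (hA : MeasurableSet A) :
    obsLaw P ξ X W θ A ^ 2 ≤ ENNReal.ofReal (Real.exp (n * u)) * obsLaw P ξ X W θ' A := by
  have hv : (0 : ℝ) < v := h.v_pos
  obtain ⟨t, ht⟩ : ∃ t : ℝ≥0, (t : ℝ) = v + w * a * ‖θ‖ ^ 2 :=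
    ⟨⟨v + w * a * ‖θ‖ ^ 2, by positivity⟩, rfl⟩
  have htpos : (0 : ℝ) < t := by rw [ht]; positivity
  have ht0 : t ≠ 0 := by
    rintro rfl
    simp at htpos
  rw [obsLaw_apply h ha hl θ ht ht0 hA, obsLaw_apply h ha hl θ' (hθ ▸ ht) ht0 hA]
  have hg : Measurable fun r : Fin n → (Vec p × Vec p) × ℝ =>
      (assemble fun i => ((r i).2, (r i).1.1 + (r i).1.2) : Obs n p) := by fun_prop
  have hm : ∀ θ : Vec p, Measurable fun d : Vec p × Vec p =>
      (inner ℝ (d.1 + (a : ℝ) • d.2) θ : ℝ) := fun θ => by fun_prop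
  refine (regressionLaw_pi_sq_le n _ ht0 (hm θ) (hm θ') (hg hA)).trans ?_
  gcongr
  rw [Real.exp_nat_mul, ENNReal.ofReal_pow (Real.exp_pos _).le]
  gcongr
  have hS' := posSemidef_sub_smul_one h.posDef.posSemidef hl
  set δ := θ - θ'
  have hnn : 0 ≤ δ.ofLp ⬝ᵥ (S - (l : ℝ) • 1).mulVec δ.ofLp := by
    simpa using hS'.re_dotProduct_nonneg δ.ofLp
  obtain ⟨x, hx⟩ : ∃ x : ℝ≥0, (x : ℝ) = δ.ofLp ⬝ᵥ (S - (l : ℝ) • 1).mulVec δ.ofLp +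
      a ^ 2 * ((l + w : ℝ≥0) : ℝ) * ‖δ‖ ^ 2 := ⟨⟨_, by positivity⟩, rfl⟩
  have ha' : (a : ℝ) * (l + w) = l := by exact_mod_cast ha
  have hw : (0 : ℝ) < w := h.w_pos
  have ha1 : (a : ℝ) ≤ 1 := by
    by_contra hcon
    push Not at hcon
    nlinarith [l.coe_nonneg]
  -- The isotropic term `a² (l + w)` is at most the `l` removed from `S`, so the variance does not
  -- exceed that of `⟪X, δ⟫`.
  have hxle : (x : ℝ) ≤ l' * ‖δ‖ ^ 2 := by
    have h1 := dotProduct_mulVec_le h.posDef.posSemidef hl' δ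
    have h2 : (a : ℝ) ^ 2 * (l + w) ≤ l := by
      rw [pow_two, mul_assoc, ha']
      exact mul_le_of_le_one_left l.coe_nonneg ha1
    have h3 := mul_le_mul_of_nonneg_right h2 (sq_nonneg ‖δ‖)
    rw [hx, dotProduct_smul_one_mulVec]
    push_cast
    linarith
  have hxu : 2 * (1 / (t : ℝ)) * x ≤ u := by
    refine le_trans ?_ hu
    rw [← ht, mul_one_div, div_mul_eq_mul_div, mul_assoc]
    gcongr
  have hmap := map_inner_prod_eq_gaussianReal a (l + w) hS' δ hx
  calc ∫⁻ d, ENNReal.ofReal (Real.exp ((inner ℝ (d.1 + (a : ℝ) • d.2) θ -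
        inner ℝ (d.1 + (a : ℝ) • d.2) θ') ^ 2 / t))
        ∂((multivariateGaussian 0 (S - (l : ℝ) • 1)).prod (isoGaussian p (l + w)))
      = ∫⁻ z, ENNReal.ofReal (Real.exp (1 / t * z ^ 2)) ∂(gaussianReal 0 x) := by
        rw [← hmap, lintegral_map (by fun_prop) (by fun_prop)]
        refine lintegral_congr fun d => ?_
        rw [← inner_sub_right, one_div_mul_eq_div]
    _ ≤ ENNReal.ofReal (Real.exp (2 * (1 / t) * x)) :=
        lintegral_exp_mul_sq_gaussianReal (hxu.trans hu') (by positivity)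
    _ ≤ ENNReal.ofReal (Real.exp u) := by gcongr

lemma isProbabilityMeasure_obsLaw {Ω : Type*} [MeasurableSpace Ω] {P : Measure Ω}
    [IsProbabilityMeasure P] {ξ : Ω → Vec n} {X W : Ω → Rows n p} {v w : ℝ≥0}
    {S : Matrix (Fin p) (Fin p) ℝ} (h : GaussianDesignNoise P ξ X W v w S) (θ : Vec p) :
    IsProbabilityMeasure (obsLaw P ξ X W θ) := by
  rw [obsLaw_eq h]
  exact Measure.isProbabilityMeasure_map (by fun_prop)

end ObsChangeOfMeasure

/-! ### Testing block by block -/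

section BlockTesting

variable {Y : Type*} [MeasurableSpace Y] {k m : ℕ}

/-- Exchanging `J b` with `j` is an involution on pairs `(J, j)`: resampling one block preserves the
uniform average. -/
lemma card_mul_sum_eq_sum_update (b : Fin k) (g : (Fin k → Fin m) → ℝ) :
    (m : ℝ) * ∑ J, g J = ∑ J, ∑ j, g (Function.update J b j) := by
  have h1 : ∑ J, ∑ j, g (Function.update J b j) =
      ∑ x : (Fin k → Fin m) × Fin m, g (Function.update x.1 b x.2) := by
    rw [Fintype.sum_prod_type]
  have h2 : ∑ x : (Fin k → Fin m) × Fin m, g (Function.update x.1 b x.2) =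
      ∑ x : (Fin k → Fin m) × Fin m, g x.1 := by
    have hinv : Function.Involutive fun x : (Fin k → Fin m) × Fin m =>
        (Function.update x.1 b x.2, x.1 b) := by
      rintro ⟨J, j⟩
      simp
    exact Equiv.sum_comp hinv.toPerm (fun x => g x.1)
  rw [h1, h2, Fintype.sum_prod_type]
  simp [Finset.mul_sum]

/-- If the laws of `m` hypotheses are close to a common law `Q`, then no test can identify the
true hypothesis with a small error probability. -/
lemma sum_real_disjoint_le (P : Fin m → Measure Y) (Q : Measure Y) [IsProbabilityMeasure Q]
    {A : Fin m → Set Y} (hA : ∀ j, MeasurableSet (A j)) (hd : Pairwise (Function.onFun Disjoint A))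
    {B : ℝ} (hB0 : 0 ≤ B) (hB : ∀ j, (P j).real (A j) ^ 2 ≤ B * Q.real (A j))
    (hBm : B ≤ 81 / 100 * m) :
    ∑ j, (P j).real (A j) ≤ 9 / 10 * m := by
  -- Disjointness caps the total `Q`-mass, so the sum of squares is at most `B`; Cauchy–Schwarz then
  -- gives `√(m B) ≤ 0.9 m`.
  have h1 : ∑ j, Q.real (A j) ≤ 1 := by
    rw [← measureReal_biUnion_finset (fun i _ j _ hij => hd hij) (fun j _ => hA j)]
    exact measureReal_le_one
  have h2 : (∑ j, (P j).real (A j)) ^ 2 ≤ (m : ℝ) * ∑ j, (P j).real (A j) ^ 2 := by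
    simpa using sq_sum_le_card_mul_sum_sq (s := Finset.univ) (f := fun j => (P j).real (A j))
  have h3 : ∑ j, (P j).real (A j) ^ 2 ≤ B := by
    calc _ ≤ ∑ j, B * Q.real (A j) := Finset.sum_le_sum fun j _ => hB j
      _ = B * ∑ j, Q.real (A j) := by rw [Finset.mul_sum]
      _ ≤ B := mul_le_of_le_one_right hB0 h1
  refine le_of_sq_le_sq ?_ (by positivity)
  calc _ ≤ (m : ℝ) * B := h2.trans (by gcongr)
    _ ≤ m * (81 / 100 * m) := by gcongr
    _ = (9 / 10 * m) ^ 2 := by ring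

/-- Average over `J` and resample block `b`. The `m` resulting hypotheses differ only in that block,
and `Q J` itself serves as their common reference law. -/
lemma exists_sum_real_le (hm : 0 < m) (Q : (Fin k → Fin m) → Measure Y)
    [∀ J, IsProbabilityMeasure (Q J)] {A : Fin k → Fin m → Set Y}
    (hA : ∀ b j, MeasurableSet (A b j)) (hd : ∀ b, Pairwise (Function.onFun Disjoint (A b)))
    {B : ℝ} (hB0 : 0 ≤ B)
    (hB : ∀ J b j, (Q (Function.update J b j)).real (A b j) ^ 2 ≤ B * (Q J).real (A b j))
    (hBm : B ≤ 81 / 100 * m) :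
    ∃ J, ∑ b, (Q J).real (A b (J b)) ≤ 9 / 10 * k := by
  by_contra! hcon
  have hm' : (0 : ℝ) < m := by exact_mod_cast hm
  have hne : Nonempty (Fin k → Fin m) := ⟨fun _ => ⟨0, hm⟩⟩
  have h1 : ∀ b, ∑ J, (Q J).real (A b (J b)) ≤ ∑ _J : Fin k → Fin m, (9 / 10 : ℝ) := by
    intro b
    have h2 := card_mul_sum_eq_sum_update b fun J => (Q J).real (A b (J b))
    have h3 : (m : ℝ) * ∑ J, (Q J).real (A b (J b)) ≤ m * ∑ _J : Fin k → Fin m, (9 / 10 : ℝ) := by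
      rw [h2, Finset.mul_sum]
      refine Finset.sum_le_sum fun J _ => ?_
      simp only [Function.update_self]
      rw [mul_comm]
      exact sum_real_disjoint_le (fun j => Q (Function.update J b j)) (Q J) (hA b) (hd b) hB0
        (hB J b) hBm
    exact le_of_mul_le_mul_left h3 hm'
  have h4 : ∑ J, ∑ b, (Q J).real (A b (J b)) ≤ ∑ _J : Fin k → Fin m, (9 / 10 * k : ℝ) := by
    rw [Finset.sum_comm]
    refine (Finset.sum_le_sum fun b _ => h1 b).trans_eq ?_
    simp
    ring
  exact h4.not_gt (Finset.sum_lt_sum_of_nonempty Finset.univ_nonempty fun J _ => hcon J)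

/-- Markov's inequality for the number of correct blocks, of mean at most `9 k / 10`: it reaches `19
k / 20` with probability at most `18/19`, and `1/19 ≥ 1/20`. -/
lemma measureReal_many_errors (hk : 0 < k) (Q : Measure Y) [IsProbabilityMeasure Q]
    {A : Fin k → Set Y} (hA : ∀ b, MeasurableSet (A b))
    (hs : ∑ b, Q.real (A b) ≤ 9 / 10 * k) :
    1 / 20 ≤ Q.real {y | (k : ℝ) / 20 ≤ ({b | y ∉ A b} : Set (Fin k)).ncard} := by
  classical
  have hk' : (0 : ℝ) < k := by exact_mod_cast hk
  set f : Y → ℝ := fun y => ∑ b, (A b).indicator 1 y with hf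
  have hfm : Measurable f :=
    Finset.measurable_sum _ fun b _ => measurable_one.indicator (hA b)
  have hint : ∀ b, Integrable ((A b).indicator (1 : Y → ℝ)) Q := fun b =>
    (integrable_const (1 : ℝ)).indicator (hA b)
  have h1 := mul_meas_ge_le_integral_of_nonneg (μ := Q) (f := f)
    (Filter.Eventually.of_forall fun y => Finset.sum_nonneg fun b _ =>
      Set.indicator_nonneg (fun _ _ => zero_le_one) _)
    (integrable_finsetSum _ fun b _ => hint b) (19 / 20 * k)
  have h2 : ∫ y, f y ∂Q = ∑ b, Q.real (A b) := by
    rw [hf, integral_finsetSum _ fun b _ => hint b]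
    exact Finset.sum_congr rfl fun b _ => integral_indicator_one (hA b)
  have hcount : ∀ y, f y + ({b | y ∉ A b} : Set (Fin k)).ncard = k := by
    intro y
    have e1 : f y = ((Finset.univ.filter fun b => y ∈ A b).card : ℝ) := by
      rw [hf, Finset.card_filter]
      push_cast
      exact Finset.sum_congr rfl fun b _ => by simp [Set.indicator_apply]
    have e2 : ({b | y ∉ A b} : Set (Fin k)).ncard =
        (Finset.univ.filter fun b => y ∉ A b).card := by
      rw [← Set.ncard_coe_finset]; simp
    have e3 := Finset.card_filter_add_card_filter_not (s := (Finset.univ : Finset (Fin k)))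
      (fun b => y ∈ A b)
    rw [e1, e2]
    rw [Finset.card_univ, Fintype.card_fin] at e3
    exact_mod_cast e3
  have h3 : {y | (k : ℝ) / 20 ≤ ({b | y ∉ A b} : Set (Fin k)).ncard}ᶜ ⊆
      {y | 19 / 20 * (k : ℝ) ≤ f y} := by
    intro y hy
    simp only [Set.mem_compl_iff, Set.mem_ofPred_eq, not_le] at hy ⊢
    linarith [hcount y]
  have hEm : MeasurableSet {y | (k : ℝ) / 20 ≤ ({b | y ∉ A b} : Set (Fin k)).ncard} := by
    have : {y | (k : ℝ) / 20 ≤ ({b | y ∉ A b} : Set (Fin k)).ncard} =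
        {y | f y ≤ 19 / 20 * (k : ℝ)} := by
      ext y
      simp only [Set.mem_ofPred_eq]
      constructor <;> intro h <;> linarith [hcount y]
    rw [this]
    exact measurableSet_le hfm measurable_const
  have h4 := measureReal_mono (μ := Q) h3
  rw [probReal_compl_eq_one_sub hEm] at h4
  have h5 : Q.real {y | 19 / 20 * (k : ℝ) ≤ f y} ≤ 18 / 19 := by
    have : 19 / 20 * (k : ℝ) * Q.real {y | 19 / 20 * (k : ℝ) ≤ f y} ≤ 19 / 20 * k * (18 / 19) := by
      linarith
    exact le_of_mul_le_mul_left this (by positivity)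
  linarith

end BlockTesting

/-! ### Lower bound on the `ℓ_q` norm -/

section Norms

variable {p : ℕ}

lemma le_lqNorm {q : ℝ≥0∞} (hq : 1 ≤ q) {v : Vec p} {I : Finset (Fin p)} (hI : I.Nonempty) {η : ℝ}
    (hη : 0 ≤ η) (hv : ∀ i ∈ I, η ≤ |v i|) :
    η * (I.card : ℝ) ^ (1 / q.toReal) ≤ lqNorm q v := by
  have : Fact (1 ≤ q) := ⟨hq⟩
  rcases eq_or_ne q ⊤ with rfl | hqt
  · obtain ⟨i, hi⟩ := hI
    have h1 := (hv i hi).trans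
      (PiLp.norm_apply_le (WithLp.toLp ⊤ (fun j => v j) : PiLp ⊤ (fun _ : Fin p => ℝ)) i)
    -- With `⊤.toReal = 0` and `1 / 0 = 0`, the power is `1`, matching the convention `s^(1/∞) = 1`.
    rw [ENNReal.toReal_top, div_zero, Real.rpow_zero, mul_one]
    exact h1
  · have hr : 0 < q.toReal := ENNReal.toReal_pos (by positivity) hqt
    rw [lqNorm, PiLp.norm_eq_sum hr]
    have h1 : (I.card : ℝ) * η ^ q.toReal ≤ ∑ i, ‖v i‖ ^ q.toReal := by
      calc (I.card : ℝ) * η ^ q.toReal = ∑ _i ∈ I, η ^ q.toReal := by simp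
        _ ≤ ∑ i ∈ I, ‖v i‖ ^ q.toReal := Finset.sum_le_sum fun i hi =>
          Real.rpow_le_rpow hη (hv i hi) hr.le
        _ ≤ ∑ i, ‖v i‖ ^ q.toReal := Finset.sum_le_univ_sum_of_nonneg fun i => by positivity
    calc η * (I.card : ℝ) ^ (1 / q.toReal)
        = ((I.card : ℝ) * η ^ q.toReal) ^ (1 / q.toReal) := by
          rw [Real.mul_rpow (by positivity) (by positivity), ← Real.rpow_mul hη,
            mul_one_div_cancel hr.ne', Real.rpow_one, mul_comm]
      _ ≤ _ := Real.rpow_le_rpow (by positivity) h1 (by positivity)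

end Norms

/-! ### The sparse block vectors -/

section Hypotheses

variable {p k m : ℕ}

/-- Extension of a vector by zero along an embedding of index sets. -/
def extendVec {ι : Type*} (f : ι ↪ Fin p) (h : ι → ℝ) : Vec p :=
  WithLp.toLp 2 (Function.extend f h 0)

lemma extendVec_apply {ι : Type*} (f : ι ↪ Fin p) (h : ι → ℝ) (x : ι) :
    extendVec f h (f x) = h x :=
  f.injective.extend_apply h 0 x

lemma extendVec_apply_of_notMem_range {ι : Type*} (f : ι ↪ Fin p) (h : ι → ℝ) {i : Fin p}
    (hi : ¬ ∃ x, f x = i) : extendVec f h i = 0 :=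
  Function.extend_apply' h (0 : Fin p → ℝ) i hi

lemma norm_extendVec_sq {ι : Type*} [Fintype ι] (f : ι ↪ Fin p) (h : ι → ℝ) :
    ‖extendVec f h‖ ^ 2 = ∑ x, h x ^ 2 := by
  rw [EuclideanSpace.real_norm_sq_eq]
  symm
  refine Finset.sum_of_injOn f f.injective.injOn (fun _ _ => Finset.mem_coe.2 (Finset.mem_univ _))
    (fun i _ hi => ?_) fun x _ => by rw [extendVec_apply]
  have : extendVec f h i = 0 := by
    refine extendVec_apply_of_notMem_range f h ?_
    rintro ⟨x, rfl⟩
    simp at hi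
  rw [this]; simp

lemma extendVec_sub {ι : Type*} (f : ι ↪ Fin p) (h h' : ι → ℝ) :
    extendVec f h - extendVec f h' = extendVec f (h - h') := by
  ext i
  by_cases hi : ∃ x, f x = i
  · obtain ⟨x, rfl⟩ := hi
    simp [extendVec_apply]
  · simp [extendVec_apply_of_notMem_range _ _ hi]

/-- One large component `r`, and one component `ε` in each of `k` blocks, at position `J b`. -/
def blockVec (f : Option (Fin k × Fin m) ↪ Fin p) (r ε : ℝ) (J : Fin k → Fin m) : Vec p :=
  extendVec f (fun x => x.elim r fun bj => if J bj.1 = bj.2 then ε else 0)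

variable (f : Option (Fin k × Fin m) ↪ Fin p) (r ε : ℝ) (J : Fin k → Fin m)

lemma blockVec_apply (b : Fin k) (j : Fin m) :
    blockVec f r ε J (f (some (b, j))) = if J b = j then ε else 0 :=
  extendVec_apply _ _ _

lemma norm_blockVec_sq : ‖blockVec f r ε J‖ ^ 2 = r ^ 2 + k * ε ^ 2 := by
  rw [blockVec, norm_extendVec_sq, Fintype.sum_option, Fintype.sum_prod_type]
  simp [ite_pow]

lemma norm_blockVec_update_sub_sq_le (b : Fin k) (j : Fin m) :
    ‖blockVec f r ε (Function.update J b j) - blockVec f r ε J‖ ^ 2 ≤ 2 * ε ^ 2 := by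
  rw [blockVec, blockVec, extendVec_sub, norm_extendVec_sq, Fintype.sum_option,
    Fintype.sum_prod_type, Finset.sum_eq_single b]
  · have h1 : ∀ j', ((if j = j' then ε else 0) - (if J b = j' then ε else 0)) ^ 2 ≤
        (if j = j' then ε ^ 2 else 0) + (if J b = j' then ε ^ 2 else 0) := by
      intro j'
      split_ifs <;> simp [sq_nonneg]
    have h2 := Finset.sum_le_sum fun j' (_ : j' ∈ Finset.univ) => h1 j'
    rw [Finset.sum_add_distrib] at h2
    simp only [Finset.sum_ite_eq, Finset.mem_univ, if_true] at h2
    simpa [two_mul] using h2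
  · intro b' _ hb
    simp [Function.update_of_ne hb]
  · simp

lemma blockVec_mem_B0 {s : ℕ} (hs : k + 1 ≤ s) : blockVec f r ε J ∈ B0 p s := by
  classical
  have hsub : {i : Fin p | blockVec f r ε J i ≠ 0} ⊆
      ((insert (f none) (Finset.univ.image fun b => f (some (b, J b))) : Finset (Fin p)) :
        Set (Fin p)) := by
    intro i hi
    by_cases hx : ∃ x, f x = i
    · obtain ⟨x, rfl⟩ := hx
      rcases x with _ | ⟨b, j⟩
      · simp
      · rw [Set.mem_ofPred_eq, blockVec_apply] at hi
        obtain rfl : J b = j := by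
          by_contra h
          simp [h] at hi
        simp
    · exact absurd (extendVec_apply_of_notMem_range f _ hx) hi
  refine (Set.ncard_le_ncard hsub (Finset.finite_toSet _)).trans ?_
  rw [Set.ncard_coe_finset]
  refine (Finset.card_insert_le _ _).trans (le_trans ?_ hs)
  gcongr
  exact Finset.card_image_le.trans (by simp)

end Hypotheses

/-! ### From block errors to estimation error -/

section Minimax

/-- Lower bound over the vectors with one component `ε` in each block. -/
lemma exists_blockVec_le {n p k m s : ℕ} (hk : 0 < k) (hm : 0 < m) (hks : k + 1 ≤ s)
    (f : Option (Fin k × Fin m) ↪ Fin p) {q : ℝ≥0∞} (hq : 1 ≤ q) {R ε B : ℝ} (hR : 0 ≤ R)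
    (hε : 0 < ε) (hkε : k * ε ^ 2 ≤ R ^ 2) (Q : Vec p → Measure (Obs n p))
    [∀ θ, IsProbabilityMeasure (Q θ)] (hB0 : 0 ≤ B) (hBm : B ≤ 81 / 100 * m)
    (hB : ∀ θ θ', ‖θ‖ = R → ‖θ'‖ = R → ‖θ - θ'‖ ^ 2 ≤ 2 * ε ^ 2 → ∀ A, MeasurableSet A →
      (Q θ).real A ^ 2 ≤ B * (Q θ').real A)
    {T : Obs n p → Vec p} (hT : Measurable T) :
    ∃ θ ∈ B0 p s ∩ S2 p R, 1 / 20 ≤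
      (Q θ).real {z | ε / 2 * ((k : ℝ) / 20) ^ (1 / q.toReal) ≤ lqNorm q (T z - θ)} := by
  classical
  -- The large entry absorbs the remaining norm; `hkε` makes the square root genuine.
  set θ : (Fin k → Fin m) → Vec p := blockVec f (√(R ^ 2 - k * ε ^ 2)) ε with hθ
  have hnorm : ∀ J, ‖θ J‖ = R := by
    intro J
    have h := norm_blockVec_sq f (√(R ^ 2 - k * ε ^ 2)) ε J
    rw [Real.sq_sqrt (by linarith), sub_add_cancel] at h
    exact (sq_eq_sq₀ (norm_nonneg _) hR).1 h
  -- On `A b j` the estimate is within `ε / 2` of the pattern with its entry at `j`, throughout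
  -- block `b`. Distinct `j` are incompatible, and leaving `A b (J b)` forces a coordinate error of
  -- at least `ε / 2`.
  set A : Fin k → Fin m → Set (Obs n p) := fun b j =>
    ⋂ j', {z | |T z (f (some (b, j'))) - (if j = j' then ε else 0)| < ε / 2} with hA
  have hAm : ∀ b j, MeasurableSet (A b j) := by
    intro b j
    refine MeasurableSet.iInter fun j' => measurableSet_lt (Measurable.abs ?_) measurable_const
    fun_prop
  have hAd : ∀ b, Pairwise (Function.onFun Disjoint (A b)) := by
    intro b j j' hj
    refine Set.disjoint_left.2 fun z h1 h2 => ?_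
    have h1' := Set.mem_iInter.1 h1 j
    have h2' := Set.mem_iInter.1 h2 j
    simp only [if_true, hj.symm, if_false, Set.mem_ofPred_eq, sub_zero, abs_lt] at h1' h2'
    linarith [h1'.1, h2'.2]
  obtain ⟨J, hJ⟩ := exists_sum_real_le hm (fun J => Q (θ J)) hAm hAd hB0
    (fun J b j => hB _ _ (hnorm _) (hnorm _) (norm_blockVec_update_sub_sq_le f _ ε J b j) _
      (hAm b j)) hBm
  refine ⟨θ J, ⟨blockVec_mem_B0 f _ ε J hks, hnorm J⟩, ?_⟩
  refine (measureReal_many_errors hk (Q (θ J)) (fun b => hAm b (J b)) hJ).trans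
    (measureReal_mono fun z hz => ?_)
  simp only [Set.mem_ofPred_eq] at hz ⊢
  have hk' : (0 : ℝ) < k := by exact_mod_cast hk
  set E : Finset (Fin k) := Finset.univ.filter fun b => z ∉ A b (J b) with hE
  have hcard : ({b | z ∉ A b (J b)} : Set (Fin k)).ncard = E.card := by
    rw [← Set.ncard_coe_finset]; simp [hE]
  rw [hcard] at hz
  have hwit : ∀ b, ∃ j', z ∉ A b (J b) → ε / 2 ≤ |(T z - θ J) (f (some (b, j')))| := by
    intro b
    by_cases hb : z ∈ A b (J b)
    · exact ⟨J b, fun h => absurd hb h⟩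
    · simp only [hA, Set.mem_iInter, Set.mem_ofPred_eq, not_forall, not_lt] at hb
      obtain ⟨j', hj'⟩ := hb
      refine ⟨j', fun _ => ?_⟩
      rw [PiLp.sub_apply, hθ, blockVec_apply]
      exact hj'
  choose g hg using hwit
  have hinj : Function.Injective fun b => f (some (b, g b)) := by
    intro b b' h
    simpa using congrArg (fun x : Fin k × Fin m => x.1) (Option.some.inj (f.injective h))
  have hIcard : (E.image fun b => f (some (b, g b))).card = E.card :=
    Finset.card_image_of_injective _ hinj
  have hEne : E.Nonempty := by
    rw [← Finset.card_pos]
    have : (0 : ℝ) < E.card := lt_of_lt_of_le (by positivity) hz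
    exact_mod_cast this
  refine le_trans ?_ (le_lqNorm hq (I := E.image fun b => f (some (b, g b))) (η := ε / 2)
    (hEne.image _) (by positivity) ?_)
  · rw [hIcard]
    gcongr
  · intro i hi
    obtain ⟨b, hb, rfl⟩ := Finset.mem_image.1 hi
    exact hg b (by simpa [hE] using hb)

end Minimax

/-! ### Choice of dimensions and constants -/

/-- Take `k = ⌊s/2⌋` and `m = ⌊(p-1)/k⌋`; one coordinate is reserved for the large entry. The bound
`p ≤ s m²` makes `log m` at least half of `log(p/s)`, and `s < p` ensures `m ≥ 2`. -/
lemma exists_blocks {p s : ℕ} (hs : 2 ≤ s) (hsp : s < p) :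
    ∃ k m : ℕ, 0 < k ∧ 2 ≤ m ∧ k + 1 ≤ s ∧ s ≤ 3 * k ∧ k * m + 1 ≤ p ∧ p ≤ s * m ^ 2 := by
  have hk : 0 < s / 2 := by omega
  have hm : 2 ≤ (p - 1) / (s / 2) := by
    rw [Nat.le_div_iff_mul_le hk]; omega
  refine ⟨s / 2, (p - 1) / (s / 2), hk, hm, by omega, by omega, ?_, ?_⟩
  · have := Nat.mul_div_le (p - 1) (s / 2); omega
  · have h1 := Nat.lt_mul_div_succ (p - 1) hk
    set m := (p - 1) / (s / 2)
    have h2 : m + 1 ≤ m ^ 2 := by nlinarith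
    calc p ≤ s / 2 * (m + 1) := by omega
      _ ≤ s * m ^ 2 := Nat.mul_le_mul (by omega) h2

/-- Since `p / s ≤ m²` and `κ ≤ 1/4`, the left side is at most `√m`, which is below `0.81 m` once `m
≥ 2`. -/
lemma exp_mul_log_le {p s m : ℕ} (hs : 0 < s) (hp : 0 < p) (hm : 2 ≤ m) (h : p ≤ s * m ^ 2) {κ : ℝ}
    (hκ0 : 0 ≤ κ) (hκ : κ ≤ 1 / 4) : Real.exp (κ * Real.log ((p : ℝ) / s)) ≤ 81 / 100 * m := by
  have hm' : (2 : ℝ) ≤ m := by exact_mod_cast hm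
  have hs' : (0 : ℝ) < s := by exact_mod_cast hs
  have hp' : (0 : ℝ) < p := by exact_mod_cast hp
  have h1 : Real.log ((p : ℝ) / s) ≤ 2 * Real.log m := by
    have : Real.log ((m : ℝ) ^ 2) = 2 * Real.log m := by simp
    rw [← this]
    refine Real.log_le_log (by positivity) ?_
    rw [div_le_iff₀ hs', mul_comm]
    exact_mod_cast h
  have hlog : 0 ≤ Real.log m := Real.log_nonneg (by linarith)
  have h2 : κ * Real.log ((p : ℝ) / s) ≤ Real.log m / 2 := by
    calc κ * Real.log ((p : ℝ) / s) ≤ κ * (2 * Real.log m) := by gcongr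
      _ ≤ 1 / 4 * (2 * Real.log m) := by gcongr
      _ = _ := by ring
  have h3 : Real.exp (κ * Real.log ((p : ℝ) / s)) ^ 2 ≤ m := by
    rw [← Real.exp_nat_mul]
    calc _ ≤ Real.exp (Real.log m) := by
          gcongr
          push_cast
          linarith
      _ = m := Real.exp_log (by linarith)
  refine le_of_sq_le_sq (h3.trans ?_) (by positivity)
  nlinarith

/-- The minimax lower bound for a fixed estimator, when `s < p`. -/
lemma exists_mem_le_obsLaw {n p s : ℕ} {R : ℝ} {S : Matrix (Fin p) (Fin p) ℝ}
    {Ω : Type*} [MeasurableSpace Ω] {P : Measure Ω} [IsProbabilityMeasure P]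
    {ξ : Ω → Vec n} {X W : Ω → Rows n p} {v w : ℝ≥0} {lmin lmax cbar c₀ τ : ℝ}
    (h : GaussianDesignNoise P ξ X W v w S) (hlmin : 0 < lmin)
    (h1 : lmin ∈ lowerBounds (spectrum ℝ S)) (h2 : lmax ∈ upperBounds (spectrum ℝ S))
    (hlmax : 0 < lmax) (hc₀ : 0 < c₀) (hτ : 0 < τ) (hτv : τ ≤ v)
    (hτw : τ ≤ w * (lmin / (lmin + w)))
    (hcb : 2 * c₀ ^ 2 * cbar ≤ 1) (hκ : 8 * lmax * c₀ ^ 2 / τ ≤ 1 / 4)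
    (hκc : 8 * lmax * c₀ ^ 2 / τ * cbar ≤ 1 / 2)
    (hn : 1 ≤ n) (hs : 2 ≤ s) (hsp : s < p) (hR : 0 < R) (hcbar : 0 < cbar)
    (hrate : (s : ℝ) * Real.log ((p : ℝ) / s) / n ≤ cbar * R ^ 2 / (R ^ 2 + 1))
    {q : ℝ≥0∞} (hq : 1 ≤ q) {T : Obs n p → Vec p} (hT : Measurable T) :
    ∃ θ ∈ B0 p s ∩ S2 p R, 1 / 20 ≤ (obsLaw P ξ X W θ).real
      {z | c₀ / 2 * (1 / 60) ^ (1 / q.toReal) * (s : ℝ) ^ (1 / q.toReal) *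
        √(Real.log ((p : ℝ) / s) / n) * (R + 1) ≤ lqNorm q (T z - θ)} := by
  obtain ⟨k, m, hk, hm, hks, hsk, hkm, hpm⟩ := exists_blocks hs hsp
  have hn' : (0 : ℝ) < n := by exact_mod_cast hn
  have hs' : (2 : ℝ) ≤ s := by exact_mod_cast hs
  have hsp' : (s : ℝ) < p := by exact_mod_cast hsp
  have hw : (0 : ℝ) < w := h.w_pos
  set ℓ := Real.log ((p : ℝ) / s) with hℓ
  have hℓ0 : 0 < ℓ := Real.log_pos (by rw [lt_div_iff₀ (by linarith)]; linarith)
  set g := ℓ / n with hg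
  have hg0 : 0 < g := by positivity
  set ε := c₀ * √g * (R + 1) with hε
  have hε0 : 0 < ε := by positivity
  have hεsq : ε ^ 2 ≤ 2 * c₀ ^ 2 * g * (R ^ 2 + 1) := by
    rw [hε, mul_pow, mul_pow, Real.sq_sqrt hg0.le]
    have : (R + 1) ^ 2 ≤ 2 * (R ^ 2 + 1) := by nlinarith [sq_nonneg (R - 1)]
    calc c₀ ^ 2 * g * (R + 1) ^ 2 ≤ c₀ ^ 2 * g * (2 * (R ^ 2 + 1)) := by gcongr
      _ = _ := by ring
  have hrate' : s * g * (R ^ 2 + 1) ≤ cbar * R ^ 2 := by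
    rw [le_div_iff₀ (by positivity), mul_div_assoc] at hrate
    exact hrate
  have hkε : k * ε ^ 2 ≤ R ^ 2 := by
    have hks' : (k : ℝ) ≤ s := by exact_mod_cast (by omega : k ≤ s)
    calc (k : ℝ) * ε ^ 2 ≤ s * (2 * c₀ ^ 2 * g * (R ^ 2 + 1)) := by gcongr
      _ = 2 * c₀ ^ 2 * (s * g * (R ^ 2 + 1)) := by ring
      _ ≤ 2 * c₀ ^ 2 * (cbar * R ^ 2) := by gcongr
      _ = (2 * c₀ ^ 2 * cbar) * R ^ 2 := by ring
      _ ≤ R ^ 2 := mul_le_of_le_one_left (sq_nonneg R) hcb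
  -- The rate condition also bounds `g` by a constant, which keeps `κ g` in the range `≤ 1/2` of the
  -- exponential moment bound.
  have hgle : g ≤ cbar := by
    have h3 : s * g * (R ^ 2 + 1) ≤ cbar * (R ^ 2 + 1) := by nlinarith
    have h4 := le_of_mul_le_mul_right h3 (by positivity)
    nlinarith
  set κ := 8 * lmax * c₀ ^ 2 / τ with hκdef
  have hκ0 : 0 ≤ κ := by positivity
  have hu' : κ * g ≤ 1 / 2 := (mul_le_mul_of_nonneg_left hgle hκ0).trans hκc
  obtain ⟨f⟩ : Nonempty (Option (Fin k × Fin m) ↪ Fin p) :=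
    Function.Embedding.nonempty_of_card_le (by simpa using hkm)
  obtain ⟨l, rfl⟩ : ∃ l : ℝ≥0, (l : ℝ) = lmin := ⟨⟨lmin, hlmin.le⟩, rfl⟩
  have hlw : l + w ≠ 0 := by
    intro h0
    have : (l : ℝ) + w = 0 := by exact_mod_cast h0
    linarith
  have hprob : ∀ θ, IsProbabilityMeasure (obsLaw P ξ X W θ) := isProbabilityMeasure_obsLaw h
  have hchange : ∀ θ θ', ‖θ‖ = R → ‖θ'‖ = R → ‖θ - θ'‖ ^ 2 ≤ 2 * ε ^ 2 → ∀ A, MeasurableSet A →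
      (obsLaw P ξ X W θ).real A ^ 2 ≤ Real.exp (κ * ℓ) * (obsLaw P ξ X W θ').real A := by
    intro θ θ' hθ hθ' hd A hA
    have ha : l / (l + w) * (l + w) = l := div_mul_cancel₀ _ hlw
    have hu : 2 * lmax * ‖θ - θ'‖ ^ 2 / (v + w * ((l / (l + w) : ℝ≥0) : ℝ) * ‖θ‖ ^ 2) ≤ κ * g := by
      -- The noise variance grows like `R² + 1` and cancels the same factor in `ε²`, so `κ` is free
      -- of `R`.
      have hden : τ * (R ^ 2 + 1) ≤ v + w * ((l / (l + w) : ℝ≥0) : ℝ) * ‖θ‖ ^ 2 := by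
        rw [hθ]
        push_cast
        have := mul_le_mul_of_nonneg_right hτw (sq_nonneg R)
        linarith
      calc 2 * lmax * ‖θ - θ'‖ ^ 2 / (v + w * ((l / (l + w) : ℝ≥0) : ℝ) * ‖θ‖ ^ 2)
          ≤ 2 * lmax * (2 * (2 * c₀ ^ 2 * g * (R ^ 2 + 1))) / (τ * (R ^ 2 + 1)) := by
            gcongr
            exact hd.trans (by gcongr)
        _ = κ * g := by rw [hκdef]; field_simp; ring
    have key := obsLaw_sq_le h ha h1 h2 (hθ.trans hθ'.symm) hu hu' hA
    have hnu : (n : ℝ) * (κ * g) = κ * ℓ := by rw [hg]; field_simp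
    rw [hnu] at key
    have key' := ENNReal.toReal_mono
      (ENNReal.mul_ne_top ENNReal.ofReal_ne_top (measure_ne_top _ _)) key
    rwa [ENNReal.toReal_pow, ENNReal.toReal_mul, ENNReal.toReal_ofReal (Real.exp_pos _).le] at key'
  obtain ⟨θ, hθ, hle⟩ := exists_blockVec_le hk (by omega) hks f hq hR.le hε0 hkε
    (fun θ => obsLaw P ξ X W θ) (Real.exp_pos (κ * ℓ)).le
    (exp_mul_log_le (by omega) (by omega) hm hpm hκ0 hκ) hchange hT
  refine ⟨θ, hθ, hle.trans (measureReal_mono fun z hz => ?_)⟩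
  refine le_trans ?_ (Set.mem_ofPred_eq ▸ hz)
  have hsk' : (1 / 60 : ℝ) * s ≤ (k : ℝ) / 20 := by
    have : (s : ℝ) ≤ 3 * k := by exact_mod_cast hsk
    linarith
  calc c₀ / 2 * (1 / 60) ^ (1 / q.toReal) * (s : ℝ) ^ (1 / q.toReal) * √g * (R + 1)
      = ε / 2 * ((1 / 60 : ℝ) * s) ^ (1 / q.toReal) := by
        rw [Real.mul_rpow (by norm_num) (by linarith), hε]; ring
    _ ≤ ε / 2 * ((k : ℝ) / 20) ^ (1 / q.toReal) := by gcongr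

/-- Here `c₀² = 1 / M`, with `M` large enough for three demands: room for the large entry,
indistinguishable positions within a block, and a valid exponential moment. -/
lemma exists_scale {lmin lmax cbar w v : ℝ} (hv : 0 < v) (hw : 0 < w) (hlmin : 0 < lmin)
    (hlmax : 0 < lmax) (hcbar : 0 < cbar) :
    ∃ c₀ > 0, ∃ τ > 0, τ ≤ v ∧ τ ≤ w * (lmin / (lmin + w)) ∧ 2 * c₀ ^ 2 * cbar ≤ 1 ∧
      8 * lmax * c₀ ^ 2 / τ ≤ 1 / 4 ∧ 8 * lmax * c₀ ^ 2 / τ * cbar ≤ 1 / 2 := by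
  set τ := min v (w * (lmin / (lmin + w))) with hτ
  have hτ0 : 0 < τ := lt_min hv (by positivity)
  set M := 2 * cbar + 32 * lmax / τ * (1 + cbar) with hM
  have hM0 : 0 < M := by positivity
  have hsq : (√M)⁻¹ ^ 2 = M⁻¹ := by rw [inv_pow, Real.sq_sqrt hM0.le]
  have h32 : 0 < 32 * lmax / τ := by positivity
  have e : 8 * lmax * M⁻¹ / τ = 1 / 4 * (32 * lmax / τ * M⁻¹) := by ring
  refine ⟨(√M)⁻¹, by positivity, τ, hτ0, min_le_left _ _, min_le_right _ _, ?_, ?_, ?_⟩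
  · rw [hsq, mul_right_comm, ← div_eq_mul_inv, div_le_one hM0]
    have : 0 ≤ 32 * lmax / τ * (1 + cbar) := by positivity
    linarith
  · rw [hsq, e]
    have : 32 * lmax / τ * M⁻¹ ≤ 1 := by
      rw [← div_eq_mul_inv, div_le_one hM0]
      nlinarith
    linarith
  · rw [hsq, e]
    have : 32 * lmax / τ * cbar * M⁻¹ ≤ 1 := by
      rw [← div_eq_mul_inv, div_le_one hM0]
      nlinarith
    nlinarith

lemma lqNorm_nonneg {p : ℕ} {q : ℝ≥0∞} (hq : 1 ≤ q) (x : Vec p) : 0 ≤ lqNorm q x := by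
  have : Fact (1 ≤ q) := ⟨hq⟩
  exact norm_nonneg _

lemma single_mem {p s : ℕ} (hs : 1 ≤ s) (i : Fin p) {R : ℝ} (hR : 0 ≤ R) :
    EuclideanSpace.single i R ∈ B0 p s ∩ S2 p R := by
  refine ⟨?_, by simp [S2, abs_of_nonneg hR]⟩
  have hsub : {j : Fin p | (EuclideanSpace.single i R : Vec p) j ≠ 0} ⊆ {i} := by
    intro j hj
    by_contra h
    exact hj (PiLp.single_eq_of_ne (p := 2) (β := fun _ => ℝ) h R)
  exact (Set.ncard_le_ncard hsub).trans (by simpa using hs)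

lemma spectrum_pos {p : ℕ} {S : Matrix (Fin p) (Fin p) ℝ} (hS : S.PosDef) {l : ℝ}
    (hl : l ∈ spectrum ℝ S) : 0 < l := by
  rw [hS.isHermitian.spectrum_real_eq_range_eigenvalues] at hl
  obtain ⟨i, rfl⟩ := hl
  exact hS.eigenvalues_pos i

end EIV

end

/-! ### The minimax lower bound -/

theorem theorem3 (q : ℝ≥0∞) (hq : 1 ≤ q) (v w : ℝ≥0) (cbar : ℝ) (hcbar : 0 < cbar)
    (lmin lmax : ℝ) :
    ∃ c > (0 : ℝ), ∃ c' > (0 : ℝ),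
      ∀ (n p s : ℕ) (R : ℝ) (S : Matrix (Fin p) (Fin p) ℝ)
        (Ω : Type*) [MeasurableSpace Ω] (P : Measure Ω) [IsProbabilityMeasure P]
        (ξ : Ω → EIV.Vec n) (X W : Ω → EIV.Rows n p),
        1 ≤ n → 2 ≤ p → 2 ≤ s → s ≤ p → 0 < R →
        EIV.GaussianDesignNoise P ξ X W v w S →
        IsLeast (spectrum ℝ S) lmin → IsGreatest (spectrum ℝ S) lmax →
        (s : ℝ) * Real.log ((p : ℝ) / s) / n ≤ cbar * R ^ 2 / (R ^ 2 + 1) →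
        ENNReal.ofReal c' <
          ⨅ (T : EIV.Obs n p → EIV.Vec p) (_ : Measurable T),
            ⨆ θ ∈ EIV.B0 p s ∩ EIV.S2 p R,
              EIV.obsLaw P ξ X W θ
                {yZ | c * (s : ℝ) ^ (1 / q.toReal) * Real.sqrt (Real.log ((p : ℝ) / s) / n)
                    * (R + 1) ≤ EIV.lqNorm q (T yZ - θ)} := by
  by_cases hpos : (0 < v ∧ 0 < w) ∧ 0 < lmin ∧ 0 < lmax
  swap
  -- For such parameters the model assumptions are contradictory, so any constants do.
  · refine ⟨1, one_pos, 1, one_pos, ?_⟩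
    intro n p s R S Ω _ P _ ξ X W _ _ _ _ _ h h1 h2 _
    exact absurd ⟨⟨h.v_pos, h.w_pos⟩, EIV.spectrum_pos h.posDef h1.1,
      EIV.spectrum_pos h.posDef h2.1⟩ hpos
  obtain ⟨⟨hv, hw⟩, hlmin, hlmax⟩ := hpos
  obtain ⟨c₀, hc₀, τ, hτ, hτv, hτw, e1, e2, e3⟩ :=
    EIV.exists_scale (v := v) (w := w) (by exact_mod_cast hv) (by exact_mod_cast hw) hlmin hlmax hcbar
  -- The `1/60` comes from `k / 20 ≥ s / 60`. Halving `1/20` to `1/40` keeps the inequality strict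
  -- after the infimum.
  refine ⟨c₀ / 2 * (1 / 60) ^ (1 / q.toReal), by positivity, 1 / 40, by norm_num, ?_⟩
  intro n p s R S Ω _ P _ ξ X W hn hp hs hsp hR h h1 h2 hrate
  have hlt : ENNReal.ofReal (1 / 40) < ENNReal.ofReal (1 / 20) :=
    (ENNReal.ofReal_lt_ofReal_iff (by norm_num)).2 (by norm_num)
  refine hlt.trans_le (le_iInf₂ fun T hT => ?_)
  have hprob := EIV.isProbabilityMeasure_obsLaw h
  rcases hsp.lt_or_eq with hlt | rfl
  · obtain ⟨θ, hθ, hle⟩ := EIV.exists_mem_le_obsLaw h hlmin h1.2 h2.2 hlmax hc₀ hτ hτv hτw e1 e2 e3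
      hn hs hlt hR hcbar hrate hq hT
    refine le_trans ?_ (le_iSup₂ θ hθ)
    rwa [ENNReal.ofReal_le_iff_le_toReal (measure_ne_top _ _)]
  -- If `s = p`, the logarithm is zero and the event is the whole space; only a point of `B_0(s) ∩
  -- S_2(R)` is needed.
  · refine le_trans ?_ (le_iSup₂ _ (EIV.single_mem (by omega) ⟨0, by omega⟩ hR.le))
    have h0 : (s : ℝ) ≠ 0 := by positivity
    simp only [div_self h0, Real.log_one, zero_div, Real.sqrt_zero, mul_zero, zero_mul,
      EIV.lqNorm_nonneg hq, Set.ofPred_true, measure_univ]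
    exact ENNReal.ofReal_le_one.2 (by norm_num)
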